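/- Fix integers $d\ge 0$, $L\ge 1$, $m\ge 1$ and reals $\gamma>0$, $0<C_{dl}\le C_{dh}$, $C_z$, $C_\theta\ge 0$. A problem instance $X$ consists of $n\ge1$ nodes ($n$ may vary with the instance) with features $z_i\in\mathbb R^d$, a set of labeled nodes, an adjacency matrix $W=(w_{ij})\in\mathbb R_{\ge0}^{n\times n}$ with degrees $d_i=\sum_j w_{ij}$, $D=\mathrm{diag}(d_1,\dots,d_n)$, and labels $y_i\in\{-1,1\}$. For a self-loop weight $\beta\in[0,1]$ and weights $\theta\in\mathbb R^d$, the $L$-layer Simplified Graph Convolution network predicts for node $i$ the probability $$f_{\beta,\theta}(z_i)=\sigma\big((S_\beta^{L}Z\theta)_i\big),\qquad S_\beta=(D+\beta I)^{-1/2}(W+\beta I)(D+\beta I)^{-1/2},$$ where $Z$ has rows $z_i^\top$ and $\sigma(t)=1/(1+e^{-t})$. Its margin loss on $X$ is $$H^\gamma_{\beta,\theta}(X)=\frac1n\sum_{i=1}^n\Big(\mathbf 1[a_i>0]+(1+a_i/\gamma)\,\mathbf 1\big[a_i\in[-\gamma,0]\big]\Big),\qquad a_i=(1-2f_{\beta,\theta}(z_i))\,y_i,$$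 and $\mathcal H^\gamma_{(\beta,\theta)}=\{H^\gamma_{\beta,\theta}:\beta\in[0,1],\ \|\theta\|\le C_\theta\}$. Let $$k_1=\frac{1+C_{dh}}{C_{dl}},\qquad k_2=\frac2\gamma\cdot\frac{C_{dl}^2+C_{dh}^2+C_{dh}}{C_{dl}^3}\Big(\frac{C_{dh}}{C_{dl}}\Big)^{L-1}C_zC_\theta\, s_L,\qquad k_3=\frac2\gamma k_1^{L}C_z,$$ where $s_L=\frac{k_1-k_1^L}{1-k_1}$ if $L\ge2$ and $s_1=1$, and suppose that $8\max\{k_2,k_3\}\ge 1$. Then for every sample $S=(X^{(1)},\dots,X^{(m)})$ of problem instances all of whose nodes satisfy $d_i\in[C_{dl},C_{dh}]$ and $\|z_i\|\le C_z$, the empirical Rademacher complexity $$\hat R_m(\mathcal H)=\mathbb E_{\varepsilon}\Big[\sup_{H\in\mathcal H}\frac1m\sum_{k=1}^m\varepsilon_kH(X^{(k)})\Big]\qquad(\varepsilon_1,\dots,\varepsilon_m \text{ independent uniform signs})$$ of $\mathcal H=\mathcal H^\gamma_{(\beta,\theta)}$ satisfies $$\hat R_m(\mathcal H^\gamma_{(\beta,\theta)})\le\frac4m+\frac{12\sqrt{(d+1)\log\big(16\sqrt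 m\,\max\{k_2,k_3\}\big)}}{\sqrt m}.$$ -/

import Mathlib

/-- A node-labelled problem instance with `d`-dimensional features: `n` nodes, features `z i`, a set
of labelled nodes, a nonnegative edge-weight (adjacency) matrix `W`, and binary labels `y i = ±1`. -/
structure GraphInstance (d : ℕ) where
  n : ℕ
  n_pos : 0 < n
  z : Fin n → EuclideanSpace ℝ (Fin d)
  labeled : Finset (Fin n)
  W : Matrix (Fin n) (Fin n) ℝ
  W_nonneg : ∀ i j, 0 ≤ W i j
  y : Fin n → ℤˣ

namespace GraphInstance

variable {d : ℕ}

/-- The (weighted) degree `d_i = ∑_j w_{ij}`. -/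
def degree (X : GraphInstance d) (i : Fin X.n) : ℝ := ∑ j, X.W i j

/-- The normalized adjacency matrix `(D + βI)^{-1/2} (W + βI) (D + βI)^{-1/2}` of the graph with
self-loops of weight `β` added. -/
noncomputable def propagation (X : GraphInstance d) (β : ℝ) : Matrix (Fin X.n) (Fin X.n) ℝ :=
  Matrix.diagonal (fun i => (√(X.degree i + β))⁻¹) * (X.W + β • (1 : Matrix (Fin X.n) (Fin X.n) ℝ))
    * Matrix.diagonal (fun i => (√(X.degree i + β))⁻¹)

/-- The output of the `L` linear layers of the network, `S_β ^ L Z θ`. -/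
noncomputable def embedding (X : GraphInstance d) (L : ℕ) (β : ℝ) (θ : EuclideanSpace ℝ (Fin d)) :
    Fin X.n → ℝ :=
  (X.propagation β ^ L).mulVec (fun i => inner ℝ (X.z i) θ)

/-- The predicted probability that node `i` is in class `1`. -/
noncomputable def sgc (X : GraphInstance d) (L : ℕ) (β : ℝ) (θ : EuclideanSpace ℝ (Fin d))
    (i : Fin X.n) : ℝ :=
  Real.sigmoid (X.embedding L β θ i)

end GraphInstance

/-- The margin loss `𝟏[a > 0] + (1 + a / γ) 𝟏[a ∈ [-γ, 0]]` with `a = (1 - 2 p) y`, for a predicted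
probability `p` and a label `y = ±1`. -/
noncomputable def marginLoss (γ p : ℝ) (y : ℤˣ) : ℝ :=
  let a : ℝ := (1 - 2 * p) * ((y : ℤ) : ℝ)
  (Set.Ioi (0 : ℝ)).indicator 1 a + (1 + a / γ) * (Set.Icc (-γ) 0).indicator 1 a

/-- The margin loss of the network with parameters `(β, θ)`, averaged over all nodes. -/
noncomputable def sgcLoss {d : ℕ} (L : ℕ) (γ β : ℝ) (θ : EuclideanSpace ℝ (Fin d))
    (X : GraphInstance d) : ℝ :=
  (1 / (X.n : ℝ)) * ∑ i, marginLoss γ (X.sgc L β θ i) (X.y i)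

/-- The class of margin losses with `β ∈ [0,1]` and `‖θ‖ ≤ Cθ`. -/
def sgcLossClass (d L : ℕ) (γ Cθ : ℝ) : Set (GraphInstance d → ℝ) :=
  {H | ∃ (β : ℝ) (θ : EuclideanSpace ℝ (Fin d)),
    β ∈ Set.Icc (0 : ℝ) 1 ∧ ‖θ‖ ≤ Cθ ∧ H = sgcLoss L γ β θ}

/-- The empirical Rademacher complexity of a class `𝓗` on a sample `S` of size `m`: the average over
all sign vectors `σ ∈ {±1}^m` of `sup_{H ∈ 𝓗} (1/m) ∑_k σ_k H(S_k)`. -/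
noncomputable def empiricalRademacher {𝒳 : Type*} {m : ℕ} (S : Fin m → 𝒳) (𝓗 : Set (𝒳 → ℝ)) : ℝ :=
  (∑ σ : Fin m → ℤˣ,
    sSup ((fun H : 𝒳 → ℝ => (1 / (m : ℝ)) * ∑ k, (((σ k : ℤˣ) : ℤ) : ℝ) * H (S k)) '' 𝓗)) / 2 ^ m

/-- `k₁ = (1 + C_dh) / C_dl`. -/
noncomputable def sgcK1 (Cdl Cdh : ℝ) : ℝ := (1 + Cdh) / Cdl

/-- The factor `(k₁ - k₁^L) / (1 - k₁)` for `L ≥ 2`, and `1` for a single layer. -/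
noncomputable def sgcGeom (L : ℕ) (k₁ : ℝ) : ℝ :=
  if L = 1 then 1 else (k₁ - k₁ ^ L) / (1 - k₁)

/-- `k₂`. -/
noncomputable def sgcK2 (L : ℕ) (γ Cdl Cdh Cz Cθ : ℝ) : ℝ :=
  2 / γ * ((Cdl ^ 2 + Cdh ^ 2 + Cdh) / Cdl ^ 3) * (Cdh / Cdl) ^ (L - 1) * Cz * Cθ
    * sgcGeom L (sgcK1 Cdl Cdh)

/-- `k₃`. -/
noncomputable def sgcK3 (L : ℕ) (γ Cdl Cdh Cz : ℝ) : ℝ :=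
  2 / γ * sgcK1 Cdl Cdh ^ L * Cz

/-! The Rademacher complexity is bounded by covering only the self-loop weight `β` and treating the
weights `θ` by a Vapnik–Chervonenkis argument, so that the radius `Cθ` enters only through `k₂`.

* For fixed `θ` the loss is `k₂`-Lipschitz in `β` (`abs_sgcLoss_sub_le`). The propagation matrix is
  diagonally conjugate to the row-stochastic matrix `(D + βI)⁻¹ (W + βI)`, so its powers are bounded
  in the supremum norm uniformly in `L`, and telescoping gives a Lipschitz constant linear in `L`,
  which the geometric factor in `k₂` dominates. With `N = ⌈√m M⌉`, `M = max k₂ k₃`, restricting `β`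
  to the grid `{0, 1/N, …, 1}` costs `1/√m`.
* For fixed `β` the loss of a node is an antitone function, with values in `[0, 1]`, of a linear
  functional of `θ`. Rounding its values to multiples of `1/m` makes it an average of indicators of
  half-lines at a cost of `1/m`. The loss of a graph is then an average over its nodes and levels,
  and a signed sum of such averages is an average over all ways of selecting one node and one level
  in each graph (`sum_mul_average_eq_average_selection`). By convexity it is enough to bound the
  complexity for each selection.
* For a fixed selection and a fixed `β`, the sign patterns form a family of VC dimension at most `d`
  (`vcDim_linearPatterns_le`), hence by the Sauer–Shelah lemma there are at most `(m + 1) ^ d` of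
  them. Over the whole grid there are at most `(16 √m M) ^ (2 (d + 1))`, and Massart's lemma
  (`sum_signs_sup_le`) finishes the proof: the total is
  `1/m + (1 + 2 √((d + 1) log (16 √m M))) / √m`.

The constant `k₃` enters only through the size of `M`. -/

/-! ### Sign patterns of monotone predicates of linear functionals -/

theorem Nat.sum_Iic_choose_le_succ_pow (m d : ℕ) :
    ∑ k ∈ Finset.Iic d, m.choose k ≤ (m + 1) ^ d := by
  rw [← Nat.range_succ_eq_Iic]
  induction d with
  | zero => simp
  | succ d ih =>
    rw [Finset.sum_range_succ]
    calc _ ≤ (m + 1) ^ d + m * (m + 1) ^ d := by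
          refine add_le_add ih ((Nat.choose_le_pow m (d + 1)).trans ?_)
          rw [pow_succ']
          gcongr
          omega
      _ = (m + 1) ^ (d + 1) := by ring

section Patterns

variable {E : Type*} [NormedAddCommGroup E] [InnerProductSpace ℝ E] {m : ℕ}

open Classical in
/-- The sets of indices `k` picked out by the predicates `P k ⟪a k, θ⟫`, as the parameter `θ`
ranges over the whole space. -/
noncomputable def linearPatterns (a : Fin m → E) (P : Fin m → ℝ → Prop) :
    Finset (Finset (Fin m)) :=
  {A | ∃ θ : E, ∀ k, k ∈ A ↔ P k (inner ℝ (a k) θ)}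

theorem mem_linearPatterns {a : Fin m → E} {P : Fin m → ℝ → Prop} {A : Finset (Fin m)} :
    A ∈ linearPatterns a P ↔ ∃ θ : E, ∀ k, k ∈ A ↔ P k (inner ℝ (a k) θ) := by
  classical
  simp [linearPatterns]

/-- If every `P k` is a half-line unbounded below, the patterns shatter no set of more than `dim E`
indices. Given a linear relation `∑ g k • a k = 0`, realise the two patterns `{g > 0}` and `{g < 0}`
by `θ₁` and `θ₂`: then `g k * ⟪a k, θ₁ - θ₂⟫ < 0` wherever `g k ≠ 0`, although these numbers add up
to zero. -/
theorem vcDim_linearPatterns_le [FiniteDimensional ℝ E] (a : Fin m → E) (P : Fin m → ℝ → Prop)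
    (hP : ∀ k s t, s ≤ t → P k t → P k s) :
    (linearPatterns a P).vcDim ≤ Module.finrank ℝ E := by
  classical
  refine Finset.sup_le fun s hs => ?_
  rw [Finset.mem_shatterer] at hs
  by_contra! hlt
  have hdep : ¬ LinearIndependent ℝ (fun k : s => a k) := fun h => by
    have := h.fintype_card_le_finrank
    rw [Fintype.card_coe] at this
    omega
  obtain ⟨g, hg, i, hi⟩ := Fintype.not_linearIndependent_iff.1 hdep
  have key : ∀ q : s → Prop, ∃ θ : E, ∀ k : s, q k ↔ P k (inner ℝ (a k) θ) := by
    intro q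
    obtain ⟨u, hu, hsu⟩ := hs (t := s.filter fun k => ∃ h : k ∈ s, q ⟨k, h⟩)
      (Finset.filter_subset _ _)
    obtain ⟨θ, hθ⟩ := mem_linearPatterns.1 hu
    refine ⟨θ, fun k => ?_⟩
    have := congrArg (fun t => (k : Fin m) ∈ t) hsu
    simp only [Finset.mem_inter, Finset.mem_filter, k.2, true_and, exists_true_left] at this
    rw [← hθ k, this]
  obtain ⟨θ₁, h₁⟩ := key fun k => 0 < g k
  obtain ⟨θ₂, h₂⟩ := key fun k => g k < 0
  have hneg : ∀ k : s, g k ≠ 0 → g k * inner ℝ (a k) (θ₁ - θ₂) < 0 := by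
    intro k hk
    rw [inner_sub_right]
    rcases lt_or_gt_of_ne hk with h | h
    · have hp := (h₂ k).1 h
      have hn : ¬ P k (inner ℝ (a k) θ₁) := fun h' => absurd ((h₁ k).2 h') (by linarith)
      have : inner ℝ (a k) θ₂ < inner ℝ (a k) θ₁ := by
        by_contra! hle
        exact hn (hP k _ _ hle hp)
      exact mul_neg_of_neg_of_pos h (by linarith)
    · have hp := (h₁ k).1 h
      have hn : ¬ P k (inner ℝ (a k) θ₂) := fun h' => absurd ((h₂ k).2 h') (by linarith)
      have : inner ℝ (a k) θ₁ < inner ℝ (a k) θ₂ := by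
        by_contra! hle
        exact hn (hP k _ _ hle hp)
      exact mul_neg_of_pos_of_neg h (by linarith)
  have hsum : ∑ k : s, g k * inner ℝ (a k) (θ₁ - θ₂) = 0 := by
    have := congrArg (fun v => inner ℝ v (θ₁ - θ₂)) hg
    simpa [sum_inner, real_inner_smul_left] using this
  have : ∑ k : s, g k * inner ℝ (a k) (θ₁ - θ₂) < 0 := by
    refine Finset.sum_neg' (fun k _ => ?_) ⟨i, Finset.mem_univ _, hneg i hi⟩
    by_cases hk : g k = 0
    · simp [hk]
    · exact (hneg k hk).le
  linarith

theorem card_linearPatterns_le [FiniteDimensional ℝ E] (a : Fin m → E) (P : Fin m → ℝ → Prop)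
    (hP : ∀ k s t, s ≤ t → P k t → P k s) :
    (linearPatterns a P).card ≤ (m + 1) ^ Module.finrank ℝ E := by
  calc (linearPatterns a P).card ≤ (linearPatterns a P).shatterer.card :=
        Finset.card_le_card_shatterer _
    _ ≤ ∑ k ∈ Finset.Iic (linearPatterns a P).vcDim, (Fintype.card (Fin m)).choose k :=
        Finset.card_shatterer_le_sum_vcDim
    _ ≤ (m + 1) ^ (linearPatterns a P).vcDim := by
        rw [Fintype.card_fin]
        exact Nat.sum_Iic_choose_le_succ_pow _ _
    _ ≤ (m + 1) ^ Module.finrank ℝ E :=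
        Nat.pow_le_pow_right (Nat.succ_pos m) (vcDim_linearPatterns_le a P hP)

end Patterns

/-! ### Sign averages -/

theorem sum_units_int {M : Type*} [AddCommMonoid M] (f : ℤˣ → M) : ∑ u, f u = f 1 + f (-1) := by
  rw [show (Finset.univ : Finset ℤˣ) = {1, -1} from rfl, Finset.sum_pair (by decide)]

/-- The moment generating function of a sum of independent signs is sub-Gaussian. -/
theorem sum_signs_exp_le {m : ℕ} (A : Finset (Fin m)) (c : ℝ) :
    ∑ σ : Fin m → ℤˣ, Real.exp (c * ∑ k ∈ A, (((σ k : ℤˣ) : ℤ) : ℝ)) ≤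
      2 ^ m * Real.exp (m * (c ^ 2 / 2)) := by
  classical
  have h1 : ∀ σ : Fin m → ℤˣ, Real.exp (c * ∑ k ∈ A, (((σ k : ℤˣ) : ℤ) : ℝ)) =
      ∏ k, Real.exp (if k ∈ A then c * (((σ k : ℤˣ) : ℤ) : ℝ) else 0) := by
    intro σ
    rw [← Real.exp_sum, Finset.sum_ite_mem, Finset.univ_inter, Finset.mul_sum]
  simp_rw [h1]
  rw [← Fintype.prod_sum
    (fun (k : Fin m) (u : ℤˣ) => Real.exp (if k ∈ A then c * (((u : ℤˣ) : ℤ) : ℝ) else 0))]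
  calc _ ≤ ∏ _k : Fin m, (2 * Real.exp (c ^ 2 / 2)) := by
        refine Finset.prod_le_prod (fun k _ => Finset.sum_nonneg fun u _ => (Real.exp_pos _).le)
          fun k _ => ?_
        rw [sum_units_int]
        by_cases hk : k ∈ A
        · have := Real.cosh_le_exp_half_sq c
          rw [Real.cosh_eq] at this
          simp only [hk, if_true]
          push_cast
          simp only [mul_one, mul_neg]
          linarith
        · have : 1 ≤ Real.exp (c ^ 2 / 2) := Real.one_le_exp (by positivity)
          simp only [hk, if_false, Real.exp_zero]
          linarith
    _ = _ := by
        rw [Finset.prod_const, Finset.card_univ, Fintype.card_fin, mul_pow, ← Real.exp_nat_mul]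

/-- Massart's finite class lemma for indicator vectors of a family of subsets of `Fin m`. -/
theorem sum_signs_sup_le {m : ℕ} (hm : 1 ≤ m) (𝒜 : Finset (Finset (Fin m))) (h𝒜 : 𝒜.Nonempty)
    {Q : ℝ} (hQ : 0 < Q) (hcard : (𝒜.card : ℝ) ≤ Real.exp Q) :
    (∑ σ : Fin m → ℤˣ, 𝒜.sup' h𝒜 fun A => ∑ k ∈ A, (((σ k : ℤˣ) : ℤ) : ℝ)) / 2 ^ m ≤
      √(2 * m * Q) := by
  set F : (Fin m → ℤˣ) → ℝ := fun σ => 𝒜.sup' h𝒜 fun A => ∑ k ∈ A, (((σ k : ℤˣ) : ℤ) : ℝ)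
    with hF
  have hm0 : (0 : ℝ) < m := by exact_mod_cast hm
  -- the optimal exponent in the Chernoff bound
  set c : ℝ := √(2 * Q / m) with hc
  have hc0 : 0 < c := Real.sqrt_pos.2 (by positivity)
  have hc2 : c ^ 2 = 2 * Q / m := Real.sq_sqrt (by positivity)
  have hcardσ : (Fintype.card (Fin m → ℤˣ) : ℝ) = 2 ^ m := by
    simp [Fintype.card_pi]
  have hmax : ∀ σ, Real.exp (c * F σ) ≤
      ∑ A ∈ 𝒜, Real.exp (c * ∑ k ∈ A, (((σ k : ℤˣ) : ℤ) : ℝ)) := by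
    intro σ
    obtain ⟨A, hA, hAF⟩ := Finset.exists_mem_eq_sup' h𝒜
      (fun A => ∑ k ∈ A, (((σ k : ℤˣ) : ℤ) : ℝ))
    rw [hF]
    simp only
    rw [hAF]
    exact Finset.single_le_sum (f := fun A => Real.exp (c * ∑ k ∈ A, (((σ k : ℤˣ) : ℤ) : ℝ)))
      (fun A _ => (Real.exp_pos _).le) hA
  have htot : ∑ σ, Real.exp (c * F σ) ≤ 2 ^ m * Real.exp (Q + m * (c ^ 2 / 2)) := by
    calc _ ≤ ∑ σ : Fin m → ℤˣ, ∑ A ∈ 𝒜, Real.exp (c * ∑ k ∈ A, (((σ k : ℤˣ) : ℤ) : ℝ)) :=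
          Finset.sum_le_sum fun σ _ => hmax σ
      _ = ∑ A ∈ 𝒜, ∑ σ : Fin m → ℤˣ, Real.exp (c * ∑ k ∈ A, (((σ k : ℤˣ) : ℤ) : ℝ)) :=
          Finset.sum_comm
      _ ≤ ∑ A ∈ 𝒜, 2 ^ m * Real.exp (m * (c ^ 2 / 2)) :=
          Finset.sum_le_sum fun A _ => sum_signs_exp_le A c
      _ = 𝒜.card * (2 ^ m * Real.exp (m * (c ^ 2 / 2))) := by rw [Finset.sum_const, nsmul_eq_mul]
      _ ≤ Real.exp Q * (2 ^ m * Real.exp (m * (c ^ 2 / 2))) := by gcongr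
      _ = _ := by rw [Real.exp_add]; ring
  have hjensen : Real.exp (c * ((∑ σ, F σ) / 2 ^ m)) ≤ (∑ σ, Real.exp (c * F σ)) / 2 ^ m := by
    have := convexOn_exp.map_sum_le (t := (Finset.univ : Finset (Fin m → ℤˣ)))
      (w := fun _ => 1 / 2 ^ m) (p := fun σ => c * F σ) (fun _ _ => by positivity)
      (by rw [Finset.sum_const, Finset.card_univ, nsmul_eq_mul, hcardσ]; field_simp)
      (fun _ _ => Set.mem_univ _)
    simp only [smul_eq_mul, ← Finset.mul_sum] at this
    rwa [one_div_mul_eq_div, one_div_mul_eq_div, mul_div_assoc] at this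
  have hfin : c * ((∑ σ, F σ) / 2 ^ m) ≤ Q + m * (c ^ 2 / 2) := by
    rw [← Real.exp_le_exp]
    refine hjensen.trans ?_
    rw [div_le_iff₀ (by positivity)]
    linarith
  rw [hc2] at hfin
  have hprod : c * √(2 * m * Q) = 2 * Q := by
    rw [hc, ← Real.sqrt_mul (by positivity), show 2 * Q / m * (2 * m * Q) = (2 * Q) ^ 2 by
      field_simp, Real.sqrt_sq (by positivity)]
  have : c * ((∑ σ, F σ) / 2 ^ m) ≤ c * √(2 * m * Q) := by
    rw [hprod]
    refine hfin.trans_eq ?_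
    field_simp
    ring
  exact le_of_mul_le_mul_left this hc0

theorem Fintype.sum_pi_apply {ι : Type*} [Fintype ι] [DecidableEq ι] {Ω : ι → Type*}
    [∀ i, Fintype (Ω i)] [∀ i, Nonempty (Ω i)] (i : ι) (f : Ω i → ℝ) :
    (∑ ω : ∀ i, Ω i, f (ω i)) / Fintype.card (∀ i, Ω i) = (∑ w, f w) / Fintype.card (Ω i) := by
  have hc : ∀ j, (Fintype.card (Ω j) : ℝ) ≠ 0 := fun j => by
    exact_mod_cast Fintype.card_ne_zero
  -- `f (ω i)` is a product over all coordinates, so the sum over `ω` factors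
  let g : ∀ j, Ω j → ℝ := fun j w => if h : j = i then f (h ▸ w) else 1
  have h1 : ∀ ω : ∀ j, Ω j, f (ω i) = ∏ j, g j (ω j) := by
    intro ω
    rw [Finset.prod_eq_single i]
    · simp [g]
    · intro j _ hj; simp [g, hj]
    · simp
  have h2 : ∀ j, (∑ w, g j w) / Fintype.card (Ω j) =
      if j = i then (∑ w, f w) / Fintype.card (Ω i) else 1 := by
    intro j
    by_cases hj : j = i
    · subst hj; simp [g]
    · simp [g, hj, hc j]
  simp_rw [h1]
  rw [← Fintype.prod_sum g, Fintype.card_pi, Nat.cast_prod, ← Finset.prod_div_distrib]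
  simp_rw [h2]
  simp

/-- An average over signed coordinates of averages is the average, over independent selections of
one point per coordinate, of the signed sums of the selected values. -/
theorem sum_mul_average_eq_average_selection {ι : Type*} [Fintype ι] [DecidableEq ι]
    {Ω : ι → Type*} [∀ i, Fintype (Ω i)] [∀ i, Nonempty (Ω i)] (c : ι → ℝ) (f : ∀ i, Ω i → ℝ) :
    ∑ i, c i * ((∑ w, f i w) / Fintype.card (Ω i)) =
      (∑ ω : ∀ i, Ω i, ∑ i, c i * f i (ω i)) / Fintype.card (∀ i, Ω i) := by
  simp_rw [← Fintype.sum_pi_apply _ (f _)]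
  rw [Finset.sum_comm, Finset.sum_div]
  refine Finset.sum_congr rfl fun i _ => ?_
  rw [← Finset.mul_sum, mul_div_assoc]

/-- Replacing `x ∈ [0, 1]` by the fraction of the levels `0, 1/K, …, (K-1)/K` lying strictly below
it rounds `x` up to a multiple of `1/K`. -/
theorem abs_sub_average_levels_le {K : ℕ} (hK : 1 ≤ K) {x : ℝ} (h0 : 0 ≤ x) (h1 : x ≤ 1) :
    |x - (∑ j : Fin K, if ((j : ℕ) : ℝ) / K < x then (1 : ℝ) else 0) / K| ≤ 1 / K := by
  have hK0 : (0 : ℝ) < K := by exact_mod_cast hK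
  have hset : (Finset.range K).filter (fun j : ℕ => (j : ℝ) / K < x) = Finset.range ⌈K * x⌉₊ := by
    ext j
    simp only [Finset.mem_filter, Finset.mem_range, Nat.lt_ceil, div_lt_iff₀' hK0]
    refine ⟨fun h => h.2, fun h => ⟨?_, h⟩⟩
    have : (j : ℝ) < K := h.trans_le (mul_le_of_le_one_right hK0.le h1)
    exact_mod_cast this
  have hsum : (∑ j : Fin K, if ((j : ℕ) : ℝ) / K < x then (1 : ℝ) else 0) = ⌈K * x⌉₊ := by
    rw [Fin.sum_univ_eq_sum_range (fun j : ℕ => if (j : ℝ) / K < x then (1 : ℝ) else 0),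
      Finset.sum_boole, hset, Finset.card_range]
  rw [hsum, ← mul_div_cancel_left₀ x hK0.ne', ← sub_div, abs_div, abs_of_pos hK0,
    mul_div_cancel_left₀ x hK0.ne']
  gcongr
  have := Nat.le_ceil ((K : ℝ) * x)
  have := Nat.ceil_lt_add_one (mul_nonneg hK0.le h0)
  rw [abs_le]
  constructor <;> linarith

/-! ### The margin loss -/

theorem abs_sigmoid_sub_le (s t : ℝ) : |Real.sigmoid s - Real.sigmoid t| ≤ 1 / 4 * |s - t| := by
  have := Convex.norm_image_sub_le_of_norm_deriv_le (f := Real.sigmoid) (C := 1 / 4)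
    (s := Set.univ) (x := t) (y := s) (fun x _ => differentiable_sigmoid x) (fun x _ => ?_)
    convex_univ (Set.mem_univ _) (Set.mem_univ _)
  · simpa [Real.norm_eq_abs] using this
  · rw [Real.deriv_sigmoid, Real.norm_eq_abs, abs_of_nonneg
      (mul_nonneg (Real.sigmoid_nonneg x) (by linarith [Real.sigmoid_le_one x]))]
    nlinarith [sq_nonneg (Real.sigmoid x - 1 / 2)]

theorem marginLoss_eq_clamp {γ : ℝ} (hγ : 0 < γ) (p : ℝ) (y : ℤˣ) :
    marginLoss γ p y = max 0 (min 1 (1 + (1 - 2 * p) * ((y : ℤ) : ℝ) / γ)) := by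
  unfold marginLoss
  generalize (1 - 2 * p) * ((y : ℤ) : ℝ) = a
  simp only [Set.indicator_apply, Set.mem_Ioi, Set.mem_Icc, Pi.one_apply]
  rcases lt_or_ge 0 a with h | h
  · have h' : 0 < a / γ := by positivity
    rw [if_pos h, if_neg (by intro h'; linarith [h'.2]), min_eq_left (by linarith),
      max_eq_right zero_le_one]
    ring
  · have h' : a / γ ≤ 0 := div_nonpos_of_nonpos_of_nonneg h hγ.le
    rw [if_neg h.not_gt, min_eq_right (by linarith)]
    rcases le_or_gt (-γ) a with h2 | h2
    · have : -1 ≤ a / γ := by rw [le_div_iff₀ hγ]; linarith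
      rw [if_pos ⟨h2, h⟩, max_eq_right (by linarith)]
      ring
    · have : a / γ < -1 := by rw [div_lt_iff₀ hγ]; linarith
      rw [if_neg (by intro h'; linarith [h'.1]), max_eq_left (by linarith)]
      ring

/-- The margin loss, as a function of the product `u` of the label and the last-layer output. -/
noncomputable def logisticMarginLoss (γ u : ℝ) : ℝ :=
  max 0 (min 1 (1 + (1 - 2 * Real.sigmoid u) / γ))

theorem marginLoss_sigmoid {γ : ℝ} (hγ : 0 < γ) (s : ℝ) (y : ℤˣ) :
    marginLoss γ (Real.sigmoid s) y = logisticMarginLoss γ (((y : ℤ) : ℝ) * s) := by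
  rw [marginLoss_eq_clamp hγ, logisticMarginLoss]
  rcases Int.units_eq_one_or y with rfl | rfl
  · simp
  · have : Real.sigmoid (-s) = 1 - Real.sigmoid s := Real.sigmoid_neg s
    simp only [Units.val_neg, Units.val_one, Int.cast_neg, Int.cast_one, neg_mul, one_mul, this]
    congr 4
    ring

theorem logisticMarginLoss_nonneg (γ u : ℝ) : 0 ≤ logisticMarginLoss γ u := le_max_left _ _

theorem logisticMarginLoss_le_one (γ u : ℝ) : logisticMarginLoss γ u ≤ 1 :=
  max_le zero_le_one (min_le_left _ _)

theorem antitone_logisticMarginLoss {γ : ℝ} (hγ : 0 < γ) : Antitone (logisticMarginLoss γ) := by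
  intro s t hst
  have := Real.sigmoid_le hst
  unfold logisticMarginLoss
  gcongr

theorem abs_logisticMarginLoss_sub_le {γ : ℝ} (hγ : 0 < γ) (s t : ℝ) :
    |logisticMarginLoss γ s - logisticMarginLoss γ t| ≤ 1 / (2 * γ) * |s - t| := by
  unfold logisticMarginLoss
  calc _ ≤ |min 1 (1 + (1 - 2 * Real.sigmoid s) / γ) -
          min 1 (1 + (1 - 2 * Real.sigmoid t) / γ)| := by
        simpa using abs_max_sub_max_le_max 0 (min 1 (1 + (1 - 2 * Real.sigmoid s) / γ)) 0
          (min 1 (1 + (1 - 2 * Real.sigmoid t) / γ))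
    _ ≤ |(1 + (1 - 2 * Real.sigmoid s) / γ) - (1 + (1 - 2 * Real.sigmoid t) / γ)| := by
        have := abs_min_sub_min_le_max 1 (1 + (1 - 2 * Real.sigmoid s) / γ) 1
          (1 + (1 - 2 * Real.sigmoid t) / γ)
        simpa using this
    _ = 2 / γ * |Real.sigmoid s - Real.sigmoid t| := by
        rw [show (1 + (1 - 2 * Real.sigmoid s) / γ) - (1 + (1 - 2 * Real.sigmoid t) / γ) =
          -(2 / γ) * (Real.sigmoid s - Real.sigmoid t) by ring, abs_mul, abs_neg,
          abs_of_pos (by positivity)]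
    _ ≤ 2 / γ * (1 / 4 * |s - t|) := by gcongr; exact abs_sigmoid_sub_le s t
    _ = _ := by field_simp; norm_num

/-! ### Powers of stochastic matrices -/

section Stochastic

open Matrix

variable {n : Type*} [Fintype n] [DecidableEq n]

theorem abs_mulVec_le_of_mem_rowStochastic {P : Matrix n n ℝ} (hP : P ∈ rowStochastic ℝ n)
    {v : n → ℝ} {c : ℝ} (hv : ∀ j, |v j| ≤ c) (i : n) : |(P *ᵥ v) i| ≤ c := by
  calc |(P *ᵥ v) i| ≤ ∑ j, |P i j * v j| := Finset.abs_sum_le_sum_abs _ _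
    _ ≤ ∑ j, P i j * c := by
        refine Finset.sum_le_sum fun j _ => ?_
        rw [abs_mul, abs_of_nonneg (nonneg_of_mem_rowStochastic hP)]
        exact mul_le_mul_of_nonneg_left (hv j) (nonneg_of_mem_rowStochastic hP)
    _ = c := by rw [← Finset.sum_mul, sum_row_of_mem_rowStochastic hP, one_mul]

/-- Powers of stochastic matrices depend Lipschitz-continuously on the matrix, with a constant
linear in the exponent. -/
theorem abs_pow_mulVec_sub_le {P P' : Matrix n n ℝ} (hP : P ∈ rowStochastic ℝ n)
    (hP' : P' ∈ rowStochastic ℝ n) {η : ℝ} (hPP' : ∀ i, ∑ j, |P i j - P' i j| ≤ η)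
    {v : n → ℝ} {c : ℝ} (hc : 0 ≤ c) (hv : ∀ j, |v j| ≤ c) (L : ℕ) (i : n) :
    |(P ^ L *ᵥ v) i - (P' ^ L *ᵥ v) i| ≤ L * (η * c) := by
  induction L generalizing i with
  | zero => simp
  | succ L ih =>
    have hsplit : (P ^ (L + 1) *ᵥ v) i - (P' ^ (L + 1) *ᵥ v) i =
        (P *ᵥ (P ^ L *ᵥ v - P' ^ L *ᵥ v)) i + ((P - P') *ᵥ (P' ^ L *ᵥ v)) i := by
      rw [pow_succ', pow_succ', ← mulVec_mulVec, ← mulVec_mulVec, mulVec_sub, sub_mulVec]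
      simp
    have h1 : |(P *ᵥ (P ^ L *ᵥ v - P' ^ L *ᵥ v)) i| ≤ L * (η * c) :=
      abs_mulVec_le_of_mem_rowStochastic hP (fun j => ih j) i
    have h2 : |((P - P') *ᵥ (P' ^ L *ᵥ v)) i| ≤ η * c := by
      calc _ ≤ ∑ j, |(P - P') i j * (P' ^ L *ᵥ v) j| := Finset.abs_sum_le_sum_abs _ _
        _ ≤ ∑ j, |P i j - P' i j| * c := by
            refine Finset.sum_le_sum fun j _ => ?_
            rw [abs_mul]
            exact mul_le_mul_of_nonneg_left
              (abs_mulVec_le_of_mem_rowStochastic (pow_mem hP' L) hv j) (abs_nonneg _)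
        _ ≤ η * c := by
            rw [← Finset.sum_mul]
            exact mul_le_mul_of_nonneg_right (hPP' i) hc
    rw [hsplit]
    refine (abs_add_le _ _).trans ((add_le_add h1 h2).trans_eq ?_)
    push_cast
    ring

end Stochastic

/-! ### Dependence of the embedding on the self-loop weight -/

/-- The square root of a ratio of shifted degrees is Lipschitz in the shift. -/
theorem abs_sqrt_ratio_sub_le {a b l h β β' : ℝ} (hl : 0 < l) (ha : a ∈ Set.Icc l h)
    (hb : b ∈ Set.Icc l h) (hβ : 0 ≤ β) (hβ' : 0 ≤ β') :
    |√((a + β) / (b + β)) - √((a + β') / (b + β'))| ≤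
      (h / l) ^ 2 / (2 * l) * |β - β'| := by
  obtain ⟨ha1, ha2⟩ := ha
  obtain ⟨hb1, hb2⟩ := hb
  have hh : 0 < h := by linarith
  have hlow : ∀ t, 0 ≤ t → l / h ≤ √((a + t) / (b + t)) := by
    intro t ht
    refine Real.le_sqrt_of_sq_le ?_
    have h1 : l / h ≤ (a + t) / (b + t) := by
      rw [div_le_div_iff₀ hh (by linarith)]
      nlinarith
    have h2 : l / h ≤ 1 := (div_le_one hh).2 (by linarith)
    have h3 : 0 ≤ l / h := by positivity
    nlinarith
  have hx := hlow β hβ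
  have hy := hlow β' hβ'
  have hx2 := Real.sq_sqrt (div_nonneg (by linarith) (by linarith) : 0 ≤ (a + β) / (b + β))
  have hy2 := Real.sq_sqrt (div_nonneg (by linarith) (by linarith) : 0 ≤ (a + β') / (b + β'))
  set x := √((a + β) / (b + β))
  set y := √((a + β') / (b + β'))
  have hlh : 0 < l / h := by positivity
  have hdiff : |x ^ 2 - y ^ 2| ≤ h / l ^ 2 * |β - β'| := by
    have hb0 : 0 < b + β := by linarith
    have hb0' : 0 < b + β' := by linarith
    rw [hx2, hy2, show (a + β) / (b + β) - (a + β') / (b + β') =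
      (b - a) / ((b + β) * (b + β')) * (β - β') by field_simp; ring, abs_mul, abs_div,
      abs_of_pos (mul_pos hb0 hb0')]
    gcongr
    · rw [abs_le]; constructor <;> linarith
    · nlinarith
  have hmul : |x - y| * (2 * (l / h)) ≤ h / l ^ 2 * |β - β'| := by
    calc |x - y| * (2 * (l / h)) ≤ |x - y| * (x + y) := by gcongr; linarith
      _ = |x ^ 2 - y ^ 2| := by
          rw [show x ^ 2 - y ^ 2 = (x - y) * (x + y) by ring, abs_mul,
            abs_of_pos (show 0 < x + y by linarith)]
      _ ≤ _ := hdiff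
  rw [← le_div_iff₀ (by positivity)] at hmul
  refine hmul.trans_eq ?_
  field_simp

theorem sqrt_ratio_le {a b l h β : ℝ} (hl : 0 < l) (ha : a ∈ Set.Icc l h)
    (hb : b ∈ Set.Icc l h) (hβ : 0 ≤ β) : √((a + β) / (b + β)) ≤ h / l := by
  obtain ⟨ha1, ha2⟩ := ha
  obtain ⟨hb1, hb2⟩ := hb
  have h1 : 1 ≤ h / l := (one_le_div hl).2 (by linarith)
  refine Real.sqrt_le_iff.2 ⟨by linarith, ?_⟩
  have h2 : (a + β) / (b + β) ≤ h / l := by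
    rw [div_le_div_iff₀ (by linarith) hl]
    nlinarith
  nlinarith

namespace GraphInstance

open Matrix

variable {d : ℕ} (X : GraphInstance d)

/-- The random-walk normalization `(D + βI)^{-1} (W + βI)` of the adjacency matrix with self-loops
of weight `β`. -/
noncomputable def walk (β : ℝ) : Matrix (Fin X.n) (Fin X.n) ℝ :=
  Matrix.of fun i j => (X.W i j + if i = j then β else 0) / (X.degree i + β)

variable {X}

theorem walk_mem_rowStochastic {β : ℝ} (hβ : 0 ≤ β) (hX : ∀ i, 0 < X.degree i) :
    X.walk β ∈ rowStochastic ℝ (Fin X.n) := by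
  rw [mem_rowStochastic_iff_sum]
  refine ⟨fun i j => ?_, fun i => ?_⟩
  · have := X.W_nonneg i j
    have := hX i
    simp only [walk, of_apply]
    split_ifs <;> positivity
  · have := hX i
    simp only [walk, of_apply]
    rw [← Finset.sum_div, Finset.sum_add_distrib, Finset.sum_ite_eq, if_pos (Finset.mem_univ _)]
    exact div_self (show X.degree i + β ≠ 0 by positivity)

theorem sum_abs_walk_sub_le {l β β' : ℝ} (hl : 0 < l) (hX : ∀ i, l ≤ X.degree i) (hβ : 0 ≤ β)
    (hβ' : 0 ≤ β') (i : Fin X.n) :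
    ∑ j, |X.walk β i j - X.walk β' i j| ≤ 2 / l * |β - β'| := by
  have hd := hX i
  have h0 : 0 < X.degree i + β := by linarith
  have h0' : 0 < X.degree i + β' := by linarith
  set D := X.degree i with hD
  have hentry : ∀ j, |X.walk β i j - X.walk β' i j| ≤
      (X.W i j + if i = j then D else 0) * (|β - β'| / ((D + β) * (D + β'))) := by
    intro j
    have hw := X.W_nonneg i j
    have hsplit : X.walk β i j - X.walk β' i j =
        ((if i = j then D else 0) - X.W i j) * ((β - β') / ((D + β) * (D + β'))) := by
      simp only [walk, of_apply, ← hD]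
      split_ifs <;> field_simp <;> ring
    rw [hsplit, abs_mul, abs_div, abs_of_pos (mul_pos h0 h0')]
    gcongr
    split_ifs
    · rw [abs_le]; constructor <;> linarith
    · rw [zero_sub, abs_neg, abs_of_nonneg hw, add_zero]
  calc _ ≤ ∑ j, (X.W i j + if i = j then D else 0) * (|β - β'| / ((D + β) * (D + β'))) :=
        Finset.sum_le_sum fun j _ => hentry j
    _ = (D + D) * (|β - β'| / ((D + β) * (D + β'))) := by
        rw [← Finset.sum_mul, Finset.sum_add_distrib, Finset.sum_ite_eq,
          if_pos (Finset.mem_univ _)]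
        rfl
    _ = D / (D + β') * (2 / (D + β) * |β - β'|) := by field_simp; ring
    _ ≤ 1 * (2 / l * |β - β'|) := by
        gcongr
        · exact (div_le_one h0').2 (by linarith)
        · linarith
    _ = _ := one_mul _

/-- The symmetric normalization is diagonally conjugate to the random-walk normalization. -/
theorem propagation_pow {β : ℝ} (hX : ∀ i, 0 < X.degree i + β) (L : ℕ) :
    X.propagation β ^ L = diagonal (fun i => √(X.degree i + β)) * X.walk β ^ L *
      diagonal (fun i => (√(X.degree i + β))⁻¹) := by
  have hr : ∀ i, √(X.degree i + β) ≠ 0 := fun i => (Real.sqrt_pos.2 (hX i)).ne'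
  have hinv : diagonal (fun i => (√(X.degree i + β))⁻¹) * diagonal (fun i => √(X.degree i + β)) =
      (1 : Matrix (Fin X.n) (Fin X.n) ℝ) := by
    rw [diagonal_mul_diagonal, ← diagonal_one]
    congr 1
    funext i
    exact inv_mul_cancel₀ (hr i)
  have hone : X.propagation β = diagonal (fun i => √(X.degree i + β)) * X.walk β *
      diagonal (fun i => (√(X.degree i + β))⁻¹) := by
    ext i j
    have hsq := Real.sq_sqrt (hX i).le
    have := hr i
    simp only [propagation, walk, mul_diagonal, diagonal_mul, Matrix.add_apply, Matrix.smul_apply,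
      one_apply, smul_eq_mul, of_apply, mul_ite, mul_one, mul_zero]
    congr 1
    rw [← hsq, Real.sqrt_sq (Real.sqrt_nonneg _)]
    field_simp
  induction L with
  | zero =>
    rw [pow_zero, pow_zero, mul_one, diagonal_mul_diagonal, ← diagonal_one]
    congr 1
    funext i
    exact (mul_inv_cancel₀ (hr i)).symm
  | succ L ih =>
    rw [pow_succ, ih, hone, pow_succ]
    simp only [Matrix.mul_assoc]
    rw [← Matrix.mul_assoc (diagonal fun i => (√(X.degree i + β))⁻¹), hinv, Matrix.one_mul]

theorem embedding_eq_walk {β : ℝ} (hX : ∀ i, 0 < X.degree i + β) (L : ℕ)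
    (θ : EuclideanSpace ℝ (Fin d)) (i : Fin X.n) :
    X.embedding L β θ i = (X.walk β ^ L *ᵥ fun j =>
      √((X.degree i + β) / (X.degree j + β)) * inner ℝ (X.z j) θ) i := by
  rw [embedding, propagation_pow hX]
  simp only [mulVec, dotProduct, mul_diagonal, diagonal_mul]
  refine Finset.sum_congr rfl fun j _ => ?_
  rw [Real.sqrt_div (hX i).le]
  ring

theorem abs_embedding_sub_le {L : ℕ} {l h C β β' : ℝ} (hl : 0 < l)
    (hX : ∀ i, X.degree i ∈ Set.Icc l h) (hβ : 0 ≤ β) (hβ' : 0 ≤ β')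
    {θ : EuclideanSpace ℝ (Fin d)} (hC : ∀ j, |inner ℝ (X.z j) θ| ≤ C) (i : Fin X.n) :
    |X.embedding L β θ i - X.embedding L β' θ i| ≤
      (L * (2 / l * (h / l)) + (h / l) ^ 2 / (2 * l)) * C * |β - β'| := by
  have hpos : ∀ i, 0 < X.degree i := fun i => hl.trans_le (hX i).1
  have hC0 : 0 ≤ C := (abs_nonneg _).trans (hC i)
  have hh : 0 < h := hl.trans_le ((hX i).1.trans (hX i).2)
  set u : Fin X.n → ℝ := fun j => √((X.degree i + β) / (X.degree j + β)) * inner ℝ (X.z j) θ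
    with hu
  set u' : Fin X.n → ℝ := fun j => √((X.degree i + β') / (X.degree j + β')) * inner ℝ (X.z j) θ
    with hu'
  have hub : ∀ j, |u j| ≤ h / l * C := by
    intro j
    rw [hu, abs_mul, abs_of_nonneg (Real.sqrt_nonneg _)]
    exact mul_le_mul (sqrt_ratio_le hl (hX i) (hX j) hβ) (hC j) (abs_nonneg _) (by positivity)
  have huu' : ∀ j, |(u - u') j| ≤ (h / l) ^ 2 / (2 * l) * |β - β'| * C := by
    intro j
    rw [Pi.sub_apply, hu, hu', ← sub_mul, abs_mul]
    exact mul_le_mul (abs_sqrt_ratio_sub_le hl (hX i) (hX j) hβ hβ') (hC j) (abs_nonneg _)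
      (by positivity)
  have h1 := abs_pow_mulVec_sub_le (walk_mem_rowStochastic hβ hpos)
    (walk_mem_rowStochastic hβ' hpos)
    (sum_abs_walk_sub_le hl (fun i => (hX i).1) hβ hβ') (by positivity) hub L i
  have h2 := abs_mulVec_le_of_mem_rowStochastic (pow_mem (walk_mem_rowStochastic hβ' hpos) L)
    huu' i
  rw [embedding_eq_walk (fun i => by linarith [hpos i]), embedding_eq_walk
    (fun i => by linarith [hpos i])]
  have hsplit : (X.walk β ^ L *ᵥ u) i - (X.walk β' ^ L *ᵥ u') i =
      ((X.walk β ^ L *ᵥ u) i - (X.walk β' ^ L *ᵥ u) i) + (X.walk β' ^ L *ᵥ (u - u')) i := by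
    rw [mulVec_sub, Pi.sub_apply]
    ring
  rw [hsplit]
  refine (abs_add_le _ _).trans ((add_le_add h1 h2).trans_eq ?_)
  ring

/-- The embedding as a linear functional of the weights. -/
theorem embedding_eq_inner (L : ℕ) (β : ℝ) (θ : EuclideanSpace ℝ (Fin d)) (i : Fin X.n) :
    X.embedding L β θ i = inner ℝ (∑ j, (X.propagation β ^ L) i j • X.z j) θ := by
  simp [embedding, mulVec, dotProduct, sum_inner, real_inner_smul_left]

end GraphInstance

/-! ### The Lipschitz constant in the self-loop weight -/

theorem sub_one_le_sgcGeom {L : ℕ} (hL : 2 ≤ L) {k : ℝ} (hk : 1 < k) :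
    (L : ℝ) - 1 ≤ sgcGeom L k := by
  obtain ⟨n, rfl⟩ : ∃ n, L = n + 1 := ⟨L - 1, by omega⟩
  rw [sgcGeom, if_neg (by omega), ← neg_div_neg_eq, le_div_iff₀ (by linarith), pow_succ]
  have := one_add_mul_le_pow (show -2 ≤ k - 1 by linarith) n
  rw [add_sub_cancel] at this
  push_cast
  have hn : (0 : ℝ) ≤ n := n.cast_nonneg
  nlinarith [mul_nonneg hn (sub_nonneg.2 hk.le)]

/-- The Lipschitz constant in `β` obtained from `abs_logisticMarginLoss_sub_le` and
`GraphInstance.abs_embedding_sub_le` is at most `k₂`. -/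
theorem lipschitz_const_le_sgcK2 {L : ℕ} (hL : 1 ≤ L) {γ l h Cz Cθ : ℝ} (hγ : 0 < γ) (hl : 0 < l)
    (hlh : l ≤ h) (hCz : 0 ≤ Cz) (hCθ : 0 ≤ Cθ) :
    1 / (2 * γ) * ((L * (2 / l * (h / l)) + (h / l) ^ 2 / (2 * l)) * (Cz * Cθ)) ≤
      sgcK2 L γ l h Cz Cθ := by
  have hh : 0 < h := by linarith
  set R := h / l with hR
  have hR1 : 1 ≤ R := (one_le_div hl).2 hlh
  have hfac : (1 + R ^ 2) / l ≤ (l ^ 2 + h ^ 2 + h) / l ^ 3 := by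
    rw [hR, div_le_div_iff₀ hl (by positivity)]
    field_simp
    nlinarith
  have hk1 : 1 < sgcK1 l h := (one_lt_div hl).2 (by linarith)
  have hgeom : L * R + R ^ 2 / 4 ≤ 2 * (1 + R ^ 2) * (R ^ (L - 1) * sgcGeom L (sgcK1 l h)) := by
    rcases hL.eq_or_lt with rfl | hL2
    · simp only [sgcGeom, if_true, tsub_self, pow_zero]
      push_cast
      nlinarith
    · have hs := sub_one_le_sgcGeom hL2 hk1
      have hL' : (2 : ℝ) ≤ L := by exact_mod_cast hL2
      have hp : R ≤ R ^ (L - 1) := le_self_pow₀ hR1 (by omega)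
      have : R * (L / 2) ≤ R ^ (L - 1) * sgcGeom L (sgcK1 l h) :=
        mul_le_mul hp (by linarith) (by linarith) (by positivity)
      calc L * R + R ^ 2 / 4 ≤ 2 * (1 + R ^ 2) * (R * (L / 2)) := by
            have h3 : R ^ 2 ≤ R ^ 3 := pow_le_pow_right₀ hR1 (by norm_num)
            have h4 : 2 * R ^ 3 ≤ L * R ^ 3 := by gcongr
            nlinarith [sq_nonneg R]
        _ ≤ _ := by gcongr
  have hG0 : 0 ≤ R ^ (L - 1) * sgcGeom L (sgcK1 l h) := by
    have h1 : 0 ≤ L * R + R ^ 2 / 4 := by positivity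
    by_contra! hneg
    nlinarith [mul_neg_of_pos_of_neg (show 0 < 2 * (1 + R ^ 2) by positivity) hneg]
  calc _ = 1 / (γ * l) * (Cz * Cθ) * (L * R + R ^ 2 / 4) := by field_simp; ring
    _ ≤ 1 / (γ * l) * (Cz * Cθ) *
        (2 * (1 + R ^ 2) * (R ^ (L - 1) * sgcGeom L (sgcK1 l h))) := by gcongr
    _ = 2 / γ * (Cz * Cθ) * (R ^ (L - 1) * sgcGeom L (sgcK1 l h)) * ((1 + R ^ 2) / l) := by
        field_simp
    _ ≤ 2 / γ * (Cz * Cθ) * (R ^ (L - 1) * sgcGeom L (sgcK1 l h)) *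
        ((l ^ 2 + h ^ 2 + h) / l ^ 3) := by gcongr
    _ = _ := by rw [sgcK2]; ring

theorem abs_sgcLoss_sub_le {d L : ℕ} (hL : 1 ≤ L) {γ l h Cz Cθ : ℝ} (hγ : 0 < γ) (hl : 0 < l)
    (hlh : l ≤ h) {X : GraphInstance d} (hX : ∀ i, X.degree i ∈ Set.Icc l h)
    (hz : ∀ i, ‖X.z i‖ ≤ Cz) {β β' : ℝ} (hβ : 0 ≤ β) (hβ' : 0 ≤ β')
    {θ : EuclideanSpace ℝ (Fin d)} (hθ : ‖θ‖ ≤ Cθ) :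
    |sgcLoss L γ β θ X - sgcLoss L γ β' θ X| ≤ sgcK2 L γ l h Cz Cθ * |β - β'| := by
  have hn : (0 : ℝ) < X.n := by exact_mod_cast X.n_pos
  have hCz : 0 ≤ Cz := (norm_nonneg _).trans (hz ⟨0, X.n_pos⟩)
  have hCθ : 0 ≤ Cθ := (norm_nonneg _).trans hθ
  have hnode : ∀ i, |marginLoss γ (X.sgc L β θ i) (X.y i) - marginLoss γ (X.sgc L β' θ i) (X.y i)|
      ≤ sgcK2 L γ l h Cz Cθ * |β - β'| := by
    intro i
    simp only [GraphInstance.sgc, marginLoss_sigmoid hγ]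
    refine (abs_logisticMarginLoss_sub_le hγ _ _).trans ?_
    have hy : |((X.y i : ℤ) : ℝ)| = 1 := by
      rcases Int.units_eq_one_or (X.y i) with h | h <;> simp [h]
    rw [← mul_sub, abs_mul, hy, one_mul]
    have hC : ∀ j, |inner ℝ (X.z j) θ| ≤ Cz * Cθ := fun j =>
      (abs_real_inner_le_norm _ _).trans (mul_le_mul (hz j) hθ (norm_nonneg _) hCz)
    calc _ ≤ 1 / (2 * γ) *
          ((L * (2 / l * (h / l)) + (h / l) ^ 2 / (2 * l)) * (Cz * Cθ) * |β - β'|) := by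
          gcongr
          exact GraphInstance.abs_embedding_sub_le hl hX hβ hβ' hC i
      _ = 1 / (2 * γ) *
          ((L * (2 / l * (h / l)) + (h / l) ^ 2 / (2 * l)) * (Cz * Cθ)) * |β - β'| := by ring
      _ ≤ _ := by
          gcongr
          exact lipschitz_const_le_sgcK2 hL hγ hl hlh hCz hCθ
  rw [sgcLoss, sgcLoss, ← mul_sub, ← Finset.sum_sub_distrib, abs_mul, abs_of_pos (by positivity)]
  calc _ ≤ 1 / (X.n : ℝ) * ∑ _i : Fin X.n, sgcK2 L γ l h Cz Cθ * |β - β'| := by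
        gcongr
        exact (Finset.abs_sum_le_sum_abs _ _).trans (Finset.sum_le_sum fun i _ => hnode i)
    _ = _ := by
        rw [Finset.sum_const, Finset.card_univ, Fintype.card_fin, nsmul_eq_mul]
        field_simp

/-! ### Averages of monotone functions of linear functionals -/

/-- Signed sums of averages of `φ ⟪a k i β, θ⟫`, for an antitone `φ` with values in `[0, 1]`,
finitely many `β` and arbitrary `θ`. No bound on `θ` or on the number of averaged terms enters: each
average is an average over nodes and levels of indicators of half-lines, hence an average over
selections of one node and one level per sample point, and for a fixed selection only
`#G * (m + 1) ^ dim E` sign patterns occur. -/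
theorem exists_signed_average_bound {E : Type*} [NormedAddCommGroup E] [InnerProductSpace ℝ E]
    [FiniteDimensional ℝ E] {m : ℕ} (hm : 1 ≤ m) {I : Fin m → Type*} [∀ k, Fintype (I k)]
    [∀ k, Nonempty (I k)] {B : Type*} (G : Finset B) (hG : G.Nonempty) (a : ∀ k, I k → B → E)
    {φ : ℝ → ℝ} (hφ : Antitone φ) (hφ0 : ∀ u, 0 ≤ φ u) (hφ1 : ∀ u, φ u ≤ 1) {Q : ℝ} (hQ : 0 < Q)
    (hcard : (G.card : ℝ) * ((m : ℝ) + 1) ^ Module.finrank ℝ E ≤ Real.exp Q) :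
    ∃ F : (Fin m → ℤˣ) → ℝ,
      (∀ σ, ∀ b ∈ G, ∀ θ : E, ∑ k, (((σ k : ℤˣ) : ℤ) : ℝ) *
        ((∑ i, φ (inner ℝ (a k i b) θ)) / Fintype.card (I k)) ≤ F σ) ∧
      (∑ σ, F σ) / 2 ^ m ≤ 1 + √(2 * m * Q) := by
  classical
  have hm0 : (0 : ℝ) < m := by exact_mod_cast hm
  have : Nonempty (Fin m) := ⟨⟨0, hm⟩⟩
  let Ω : Fin m → Type _ := fun k => I k × Fin m
  let P : (∀ k, Ω k) → Fin m → ℝ → Prop := fun ω k u => (((ω k).2 : ℕ) : ℝ) / m < φ u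
  let 𝒜 : (∀ k, Ω k) → Finset (Finset (Fin m)) := fun ω =>
    G.biUnion fun b => linearPatterns (fun k => a k (ω k).1 b) (P ω)
  have hmem : ∀ ω, ∀ b ∈ G, ∀ θ : E,
      Finset.univ.filter (fun k => P ω k (inner ℝ (a k (ω k).1 b) θ)) ∈ 𝒜 ω := by
    intro ω b hb θ
    exact Finset.mem_biUnion.2 ⟨b, hb, mem_linearPatterns.2 ⟨θ, fun k => by simp⟩⟩
  have hne : ∀ ω, (𝒜 ω).Nonempty := fun ω =>
    let ⟨b, hb⟩ := hG
    ⟨_, hmem ω b hb 0⟩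
  have hcard𝒜 : ∀ ω, ((𝒜 ω).card : ℝ) ≤ Real.exp Q := by
    intro ω
    refine le_trans ?_ hcard
    have : (𝒜 ω).card ≤ G.card * (m + 1) ^ Module.finrank ℝ E :=
      Finset.card_biUnion_le_card_mul _ _ _ fun b _ => card_linearPatterns_le _ _
        fun k s t hst ht => lt_of_lt_of_le ht (hφ hst)
    exact_mod_cast this
  let F₀ : (Fin m → ℤˣ) → (∀ k, Ω k) → ℝ := fun σ ω =>
    (𝒜 ω).sup' (hne ω) fun A => ∑ k ∈ A, (((σ k : ℤˣ) : ℤ) : ℝ)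
  have hcardΩ : (0 : ℝ) < Fintype.card (∀ k, Ω k) := by exact_mod_cast Fintype.card_pos
  refine ⟨fun σ => 1 + (∑ ω, F₀ σ ω) / Fintype.card (∀ k, Ω k), ?_, ?_⟩
  · intro σ b hb θ
    let f : ∀ k, Ω k → ℝ := fun k w =>
      if ((w.2 : ℕ) : ℝ) / m < φ (inner ℝ (a k w.1 b) θ) then 1 else 0
    have hround : ∀ k, |(∑ i, φ (inner ℝ (a k i b) θ)) / Fintype.card (I k) -
        (∑ w, f k w) / Fintype.card (Ω k)| ≤ 1 / m := by
      intro k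
      have hI : (0 : ℝ) < Fintype.card (I k) := by exact_mod_cast Fintype.card_pos
      have hf : (∑ w, f k w) / Fintype.card (Ω k) =
          (∑ i, (∑ j : Fin m, if ((j : ℕ) : ℝ) / m < φ (inner ℝ (a k i b) θ) then (1 : ℝ) else 0)
            / m) / Fintype.card (I k) := by
        rw [Fintype.sum_prod_type, Fintype.card_prod, Fintype.card_fin, ← Finset.sum_div,
          div_div]
        push_cast
        rw [mul_comm]
      rw [hf, ← sub_div, ← Finset.sum_sub_distrib, abs_div, abs_of_pos hI, div_le_iff₀ hI]
      refine (Finset.abs_sum_le_sum_abs _ _).trans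
        ((Finset.sum_le_sum fun i _ => abs_sub_average_levels_le hm (hφ0 _) (hφ1 _)).trans_eq ?_)
      rw [Finset.sum_const, Finset.card_univ, nsmul_eq_mul, mul_comm]
    have hσ : ∀ k, |(((σ k : ℤˣ) : ℤ) : ℝ)| = 1 := by
      intro k
      rcases Int.units_eq_one_or (σ k) with h | h <;> simp [h]
    have hsel : ∑ k, (((σ k : ℤˣ) : ℤ) : ℝ) * ((∑ w, f k w) / Fintype.card (Ω k)) ≤
        (∑ ω, F₀ σ ω) / Fintype.card (∀ k, Ω k) := by
      rw [sum_mul_average_eq_average_selection]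
      gcongr with ω
      refine le_trans (le_of_eq ?_) (Finset.le_sup' _ (hmem ω b hb θ))
      rw [Finset.sum_filter]
      refine Finset.sum_congr rfl fun k _ => ?_
      simp only [f, P, mul_ite, mul_one, mul_zero]
    have herr : ∑ k, (((σ k : ℤˣ) : ℤ) : ℝ) *
        ((∑ i, φ (inner ℝ (a k i b) θ)) / Fintype.card (I k)) -
        ∑ k, (((σ k : ℤˣ) : ℤ) : ℝ) * ((∑ w, f k w) / Fintype.card (Ω k)) ≤ 1 := by
      rw [← Finset.sum_sub_distrib]
      calc _ ≤ ∑ _k : Fin m, 1 / (m : ℝ) := by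
            refine Finset.sum_le_sum fun k _ => ?_
            rw [← mul_sub]
            refine (le_abs_self _).trans ?_
            rw [abs_mul, hσ, one_mul]
            exact hround k
        _ = 1 := by
            rw [Finset.sum_const, Finset.card_univ, Fintype.card_fin, nsmul_eq_mul]
            field_simp
    linarith
  · have hcardσ : (Fintype.card (Fin m → ℤˣ) : ℝ) = 2 ^ m := by simp [Fintype.card_pi]
    rw [Finset.sum_add_distrib, Finset.sum_const, Finset.card_univ, nsmul_eq_mul, hcardσ, mul_one,
      add_div, div_self (by positivity), ← Finset.sum_div, Finset.sum_comm, div_right_comm]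
    gcongr
    rw [div_le_iff₀ hcardΩ, Finset.sum_div]
    calc _ ≤ ∑ _ω : (∀ k, Ω k), √(2 * m * Q) :=
          Finset.sum_le_sum fun ω _ => sum_signs_sup_le hm (𝒜 ω) (hne ω) hQ (hcard𝒜 ω)
      _ = _ := by rw [Finset.sum_const, Finset.card_univ, nsmul_eq_mul, mul_comm]

/-! ### The Rademacher bound -/

theorem exists_grid_point {N : ℕ} (hN : 0 < N) {β : ℝ} (hβ : β ∈ Set.Icc (0 : ℝ) 1) :
    ∃ g ∈ Finset.range (N + 1), |β - (g : ℝ) / N| ≤ 1 / N := by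
  have hN0 : (0 : ℝ) < N := by exact_mod_cast hN
  refine ⟨⌊β * N⌋₊, ?_, ?_⟩
  · rw [Finset.mem_range, Nat.lt_succ_iff]
    exact Nat.floor_le_of_le (mul_le_of_le_one_left hN0.le hβ.2)
  · have h1 := Nat.floor_le (mul_nonneg hβ.1 hN0.le)
    have h2 := Nat.lt_floor_add_one (β * N)
    rw [show β - (⌊β * N⌋₊ : ℝ) / N = (β * N - ⌊β * N⌋₊) / N by field_simp, abs_div,
      abs_of_pos hN0]
    gcongr
    rw [abs_le]
    constructor <;> linarith

theorem sgcLoss_eq_average {d L : ℕ} {γ : ℝ} (hγ : 0 < γ) (β : ℝ) (θ : EuclideanSpace ℝ (Fin d))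
    (X : GraphInstance d) :
    sgcLoss L γ β θ X = (∑ i, logisticMarginLoss γ
      (inner ℝ (((X.y i : ℤ) : ℝ) • ∑ j, (X.propagation β ^ L) i j • X.z j) θ)) /
        Fintype.card (Fin X.n) := by
  rw [sgcLoss, Fintype.card_fin, one_div_mul_eq_div]
  congr 1
  refine Finset.sum_congr rfl fun i _ => ?_
  rw [GraphInstance.sgc, marginLoss_sigmoid hγ, GraphInstance.embedding_eq_inner,
    real_inner_smul_left]

/-- The grid and the sign patterns over a sample of size `m` together number at most
`T ^ (2 (d + 1))`, with `T = 16 √m M`. -/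
theorem grid_mul_patterns_le {m d : ℕ} (hm : 1 ≤ m) {M : ℝ} (hM : 1 ≤ 8 * M) :
    ((⌈√(m : ℝ) * M⌉₊ + 1 : ℕ) : ℝ) * ((m : ℝ) + 1) ^ d ≤
      Real.exp (2 * (d + 1) * Real.log (16 * √(m : ℝ) * M)) := by
  have hm1 : (1 : ℝ) ≤ m := by exact_mod_cast hm
  have hs1 : 1 ≤ √(m : ℝ) := Real.one_le_sqrt.2 hm1
  have hs2 : √(m : ℝ) ^ 2 = m := Real.sq_sqrt (by linarith)
  set T := 16 * √(m : ℝ) * M with hT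
  have hT2 : 2 * √(m : ℝ) ≤ T := by nlinarith
  have hceil := Nat.ceil_lt_add_one (show 0 ≤ √(m : ℝ) * M by nlinarith)
  have hN : ((⌈√(m : ℝ) * M⌉₊ + 1 : ℕ) : ℝ) ≤ T ^ 2 := by
    push_cast
    nlinarith
  have hmT : (m : ℝ) + 1 ≤ T ^ 2 := by nlinarith
  have hT0 : 0 < T := by linarith
  calc _ ≤ T ^ 2 * (T ^ 2) ^ d := by gcongr
    _ = T ^ (2 * (d + 1)) := by rw [← pow_mul, ← pow_add, mul_add, mul_one, add_comm]
    _ = _ := by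
        rw [← Real.exp_log (pow_pos hT0 _), Real.log_pow]
        push_cast
        rfl

theorem mainTheorem4 (d L m : ℕ) (hL : 1 ≤ L) (hm : 1 ≤ m)
    (γ Cdl Cdh Cz Cθ : ℝ) (hγ : 0 < γ) (hCdl : 0 < Cdl) (hCdlh : Cdl ≤ Cdh) (hCθ : 0 ≤ Cθ)
    (hscale : 1 ≤ 8 * max (sgcK2 L γ Cdl Cdh Cz Cθ) (sgcK3 L γ Cdl Cdh Cz))
    (S : Fin m → GraphInstance d)
    (hdeg : ∀ k i, (S k).degree i ∈ Set.Icc Cdl Cdh)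
    (hz : ∀ k i, ‖(S k).z i‖ ≤ Cz) :
    empiricalRademacher S (sgcLossClass d L γ Cθ) ≤
      4 / (m : ℝ) +
        12 * √(((d : ℝ) + 1) *
            Real.log (16 * √(m : ℝ) * max (sgcK2 L γ Cdl Cdh Cz Cθ) (sgcK3 L γ Cdl Cdh Cz)))
          / √(m : ℝ) := by
  have hm1 : (1 : ℝ) ≤ m := by exact_mod_cast hm
  have hm0 : (0 : ℝ) < m := by linarith
  have hs1 : 1 ≤ √(m : ℝ) := Real.one_le_sqrt.2 hm1
  have hs0 : 0 < √(m : ℝ) := by linarith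
  have hk2M := le_max_left (sgcK2 L γ Cdl Cdh Cz Cθ) (sgcK3 L γ Cdl Cdh Cz)
  set k₂ := sgcK2 L γ Cdl Cdh Cz Cθ
  set M := max k₂ (sgcK3 L γ Cdl Cdh Cz)
  set Λ := Real.log (16 * √(m : ℝ) * M)
  have hΛ : 1 / 2 ≤ Λ := by
    have : Real.log 2 ≤ Λ := Real.log_le_log (by norm_num) (by nlinarith)
    linarith [Real.log_two_gt_d9]
  have hd0 : (0 : ℝ) ≤ d := d.cast_nonneg
  set N := ⌈√(m : ℝ) * M⌉₊
  have hMN : √(m : ℝ) * M ≤ N := Nat.le_ceil _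
  have hN0 : (0 : ℝ) < N := lt_of_lt_of_le (by nlinarith) hMN
  have hN : 0 < N := by exact_mod_cast hN0
  have hne : ∀ k, Nonempty (Fin (S k).n) := fun k => ⟨⟨0, (S k).n_pos⟩⟩
  obtain ⟨F, hF, hFsum⟩ := exists_signed_average_bound (E := EuclideanSpace ℝ (Fin d)) hm
    (I := fun k => Fin (S k).n) (Finset.range (N + 1)) ⟨0, by simp⟩
    (fun k i g => (((S k).y i : ℤ) : ℝ) •
      ∑ j, ((S k).propagation ((g : ℝ) / N) ^ L) i j • (S k).z j)
    (antitone_logisticMarginLoss hγ) (logisticMarginLoss_nonneg γ) (logisticMarginLoss_le_one γ)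
    (Q := 2 * (d + 1) * Λ) (by positivity)
    (by
      rw [Finset.card_range, finrank_euclideanSpace_fin]
      exact grid_mul_patterns_le hm hscale)
  simp only [← sgcLoss_eq_average hγ] at hF
  -- moving the self-loop weight to the grid costs `k₂ / N ≤ 1 / √m`
  have hgrid : k₂ / N ≤ 1 / √(m : ℝ) := by
    rw [div_le_div_iff₀ hN0 hs0]
    nlinarith
  have hsup : ∀ σ : Fin m → ℤˣ,
      sSup ((fun H : GraphInstance d → ℝ =>
        (1 / (m : ℝ)) * ∑ k, (((σ k : ℤˣ) : ℤ) : ℝ) * H (S k)) '' sgcLossClass d L γ Cθ) ≤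
      1 / √(m : ℝ) + F σ / m := by
    intro σ
    refine csSup_le ⟨_, sgcLoss L γ 0 0, ⟨0, 0, by simp, by simpa using hCθ, rfl⟩, rfl⟩ ?_
    rintro _ ⟨_, ⟨β, θ, hβ, hθ, rfl⟩, rfl⟩
    obtain ⟨g, hg, hgβ⟩ := exists_grid_point hN hβ
    have hterm : ∀ k, (((σ k : ℤˣ) : ℤ) : ℝ) * sgcLoss L γ β θ (S k) ≤
        (((σ k : ℤˣ) : ℤ) : ℝ) * sgcLoss L γ ((g : ℝ) / N) θ (S k) + 1 / √(m : ℝ) := by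
      intro k
      have hlip := abs_sgcLoss_sub_le hL hγ hCdl hCdlh (hdeg k) (hz k) hβ.1
        (show 0 ≤ (g : ℝ) / N by positivity) hθ
      have hCz : 0 ≤ Cz := (norm_nonneg _).trans (hz k ⟨0, (S k).n_pos⟩)
      have hk2 : 0 ≤ k₂ := le_trans
        (mul_nonneg (by positivity) (mul_nonneg (by
          have := hCdl.trans_le hCdlh
          positivity) (mul_nonneg hCz hCθ)))
        (lipschitz_const_le_sgcK2 hL hγ hCdl hCdlh hCz hCθ)
      have hbound : |sgcLoss L γ β θ (S k) - sgcLoss L γ ((g : ℝ) / N) θ (S k)| ≤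
          1 / √(m : ℝ) := by
        refine hlip.trans ((mul_le_mul_of_nonneg_left hgβ hk2).trans ?_)
        rwa [mul_one_div]
      rw [abs_le] at hbound
      rcases Int.units_eq_one_or (σ k) with h | h
      · rw [h]; push_cast; linarith
      · rw [h]; push_cast; linarith
    have hsum := (Finset.sum_le_sum fun k (_ : k ∈ Finset.univ) => hterm k).trans_eq
      Finset.sum_add_distrib
    rw [Finset.sum_const, Finset.card_univ, Fintype.card_fin, nsmul_eq_mul] at hsum
    have := hF σ g hg θ
    simp only
    rw [one_div_mul_eq_div, div_le_iff₀ hm0, add_mul, div_mul_cancel₀ _ hm0.ne']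
    linarith
  have hcardσ : (Fintype.card (Fin m → ℤˣ) : ℝ) = 2 ^ m := by simp [Fintype.card_pi]
  set q := √(((d : ℝ) + 1) * Λ) with hq
  have hq1 : 1 / 2 ≤ q := Real.le_sqrt_of_sq_le (by nlinarith)
  have hQ : √(2 * m * (2 * (d + 1) * Λ)) = 2 * q * √(m : ℝ) := by
    rw [show 2 * (m : ℝ) * (2 * (d + 1) * Λ) = 2 ^ 2 * (((d : ℝ) + 1) * Λ) * m by ring,
      Real.sqrt_mul (by positivity), Real.sqrt_mul (by positivity), Real.sqrt_sq (by norm_num)]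
  rw [hQ] at hFsum
  calc empiricalRademacher S (sgcLossClass d L γ Cθ)
      ≤ (∑ σ : Fin m → ℤˣ, (1 / √(m : ℝ) + F σ / m)) / 2 ^ m := by
        rw [empiricalRademacher]
        gcongr with σ
        exact hsup σ
    _ = 1 / √(m : ℝ) + (∑ σ, F σ) / 2 ^ m / m := by
        rw [Finset.sum_add_distrib, Finset.sum_const, Finset.card_univ, nsmul_eq_mul, hcardσ,
          ← Finset.sum_div]
        field_simp
    _ ≤ 1 / √(m : ℝ) + (1 + 2 * q * √(m : ℝ)) / m := by gcongr
    _ = 1 / m + (1 + 2 * q) / √(m : ℝ) := by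
        have : √(m : ℝ) / m = 1 / √(m : ℝ) := by rw [Real.sqrt_div_self, one_div]
        rw [add_div, mul_div_assoc, this]
        ring
    _ ≤ 4 / m + 12 * q / √(m : ℝ) := by
        gcongr
        · norm_num
        · linarith
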